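/- Let $\theta\in(0,1)$ with $\theta^2=1/m$ for a positive integer $m$, and let $\mathbb N_m=\{m,m+1,\dots\}$. For $s\in[0,\theta]$ and $i\in\mathbb N_m$ put $$u_i(s)=\frac1{s+i\theta}\in[0,\theta],\qquad P_i(s)=\frac{s\theta+1}{(s+i\theta)(s+(i+1)\theta)},$$ and consider the random system with complete connections (RSCC) with state space $W=[0,\theta]$ (Borel $\sigma$-algebra, usual distance $d$), index space $X=\mathbb N_m$ (all subsets), map $u(s,i)=u_i(s)$ and transition probability $P(s,\{i\})=P_i(s)$. Let $Q(s,B)=\sum_{i\ge m,\ u_i(s)\in B}P_i(s)$ be the transition probability function of the associated Markov chain, $Q^n$ its $n$-step transition probability function, $U^nf(\cdot)=\int_0^\theta Q^n(\cdot,\mathrm ds)\,f(s)$ the powers of the transition operator $U$, and $U_n=\frac1n\sum_{k=1}^nU^k$. Let $L(W)$ be the Banach space of complex-valued Lipschitz functions on $W$ with norm $\|f\|_L=\|f\|+s(f)$, where $\|f\|=\sup_w|f(w)|$ and $s(f)=\sup_{w'\ne w''}|f(w')-f(w'')|/d(w',w'')$; write also $\|\cdot\|_L$ for the operator norm on $L(W)$.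 Finally let $$\gamma_\theta(A)=\frac1{\log(1+\theta^2)}\int_A\frac{\theta\,\mathrm dx}{1+\theta x},\qquad A\subseteq[0,\theta]\text{ Borel}.$$ For $w\in W$ and $x^{(j)}=(x_1,\dots,x_j)\in X^j$ let $wx^{(j)}=u(\cdots u(u(w,x_1),x_2)\cdots,x_j)$, and for $A\subseteq X^j$ let $P_j(w,A)=\int P(w,\mathrm dx_1)\int P(wx_1,\mathrm dx_2)\cdots\int P(wx^{(j-1)},\mathrm dx_j)\,\chi_A(x^{(j)})$. Put $$r_j=\sup_{w'\neq w''}\int_{X^j}P_j(w',\mathrm dx^{(j)})\frac{d(w'x^{(j)},w''x^{(j)})}{d(w',w'')},\qquad R_j=\sup_{A\subseteq X^j}s(P_j(\cdot,A)).$$ Then the following hold. 1. The RSCC is with contraction: $W$ is a separable metric space, $r_1<\infty$, $R_1<\infty$, and $r_j<1$ for some $j\ge1$. 2. $U$ is a Doeblin–Fortet operator: $U$ maps $L(W)$ into $L(W)$ boundedly with respect to $\|\cdot\|_L$, and there are $k\ge1$, $r\in[0,1)$ and $R<\infty$ with $s(U^kf)\le r\,s(f)+R\,\|f\|$ for all $f\in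 L(W)$. 3. The RSCC is regular with respect to $L(W)$, i.e. $U$ is ergodic and aperiodic with respect to $L(W)$. Ergodic means that there is a bounded linear operator $U^\infty$ on $L(W)$ with one-dimensional range such that $\|U_n-U^\infty\|_L\to0$; aperiodic means that there is a bounded linear operator $U^\infty$ on $L(W)$ such that $\|U^n-U^\infty\|_L\to0$. 4. $\gamma_\theta$ is a stationary probability measure for the chain: $\gamma_\theta([0,\theta])=1$ and $\int_0^\theta Q(s,B)\,\gamma_\theta(\mathrm ds)=\gamma_\theta(B)$ for every Borel $B\subseteq[0,\theta]$. Moreover there are two positive constants $q<1$ and $K$ (which may depend on $\theta$) such that $$\Bigl\|U^nf-\int_0^\theta f\,\mathrm d\gamma_\theta\Bigr\|_L\le K\,q^n\,\|f\|_L\qquad\text{for all } n\ge1 \text{ and } f\in L([0,\theta]).$$ -/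

import Mathlib

open MeasureTheory ProbabilityTheory Filter Topology
open scoped ENNReal NNReal

noncomputable section

/-! ## The Banach space of Lipschitz functions -/

/-- The supremum norm `‖f‖ = sup_w |f w|`, with values in `[0, ∞]`. -/
def supNorm {W E : Type*} [NormedAddCommGroup E] (f : W → E) : ℝ≥0∞ :=
  ⨆ w, ‖f w‖ₑ

/-- The Lipschitz seminorm `s(f) = sup_{w' ≠ w''} |f w' - f w''| / d(w', w'')`,
with values in `[0, ∞]`. -/
def lipSemi {W E : Type*} [MetricSpace W] [NormedAddCommGroup E] (f : W → E) : ℝ≥0∞ :=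
  ⨆ (v : W) (w : W) (_ : v ≠ w), ‖f v - f w‖ₑ / edist v w

/-- `‖f‖_L = ‖f‖ + s(f)`. -/
def lipNorm {W E : Type*} [MetricSpace W] [NormedAddCommGroup E] (f : W → E) : ℝ≥0∞ :=
  supNorm f + lipSemi f

theorem enorm_le_supNorm {W E : Type*} [NormedAddCommGroup E] (f : W → E) (w : W) :
    ‖f w‖ₑ ≤ supNorm f :=
  le_iSup (fun w => ‖f w‖ₑ) w

theorem lipSemi_le_iff {W E : Type*} [MetricSpace W] [NormedAddCommGroup E] (f : W → E)
    (C : ℝ≥0∞) : lipSemi f ≤ C ↔ ∀ v w, v ≠ w → ‖f v - f w‖ₑ / edist v w ≤ C := by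
  simp [lipSemi, iSup_le_iff]

theorem div_le_lipSemi {W E : Type*} [MetricSpace W] [NormedAddCommGroup E] (f : W → E)
    {v w : W} (h : v ≠ w) : ‖f v - f w‖ₑ / edist v w ≤ lipSemi f :=
  (lipSemi_le_iff f _).1 le_rfl v w h

theorem lipNorm_add_le {W E : Type*} [MetricSpace W] [NormedAddCommGroup E] (f g : W → E) :
    lipNorm (f + g) ≤ lipNorm f + lipNorm g := by
  have h1 : supNorm (f + g) ≤ supNorm f + supNorm g :=
    iSup_le fun w => (enorm_add_le _ _).trans
      (add_le_add (enorm_le_supNorm f w) (enorm_le_supNorm g w))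
  have h2 : lipSemi (f + g) ≤ lipSemi f + lipSemi g := by
    rw [lipSemi_le_iff]
    intro v w h
    refine le_trans ?_ (add_le_add (div_le_lipSemi f h) (div_le_lipSemi g h))
    rw [← ENNReal.add_div]
    refine ENNReal.div_le_div_right ?_ _
    have : (f + g) v - (f + g) w = (f v - f w) + (g v - g w) := by
      simp only [Pi.add_apply]; abel
    rw [this]
    exact enorm_add_le _ _
  unfold lipNorm
  calc _ ≤ (supNorm f + supNorm g) + (lipSemi f + lipSemi g) := add_le_add h1 h2
    _ = _ := by ring

theorem lipNorm_smul {W : Type*} [MetricSpace W] (c : ℂ) (f : W → ℂ) :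
    lipNorm (c • f) = ‖c‖ₑ * lipNorm f := by
  have h1 : supNorm (c • f) = ‖c‖ₑ * supNorm f := by
    simp [supNorm, ENNReal.mul_iSup, enorm_mul]
  have h2 : lipSemi (c • f) = ‖c‖ₑ * lipSemi f := by
    simp only [lipSemi, ENNReal.mul_iSup, Pi.smul_apply, smul_eq_mul]
    simp only [← mul_sub, enorm_mul, mul_div_assoc]
  rw [lipNorm, h1, h2, lipNorm, mul_add]

/-- The bounded complex-valued Lipschitz functions on `W`. (Boundedness is automatic when `W` is
compact, see `lipNorm_ne_top_of_lipschitzWith`.) -/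
def lipSubmodule (W : Type*) [MetricSpace W] : Submodule ℂ (W → ℂ) where
  carrier := {f | lipNorm f ≠ ⊤}
  zero_mem' := by simp [lipNorm, supNorm, lipSemi]
  add_mem' {f g} hf hg :=
    ne_top_of_le_ne_top (ENNReal.add_ne_top.2 ⟨hf, hg⟩) (lipNorm_add_le f g)
  smul_mem' c f hf := by
    simpa [lipNorm_smul] using ENNReal.mul_ne_top enorm_ne_top hf

theorem lipNorm_ne_top_of_lipschitzWith {W : Type*} [MetricSpace W] [CompactSpace W]
    {C : ℝ≥0} {f : W → ℂ} (hf : LipschitzWith C f) : lipNorm f ≠ ⊤ := by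
  refine ENNReal.add_ne_top.2 ⟨?_, ?_⟩
  · obtain ⟨B, hB⟩ := (isCompact_range hf.continuous).isBounded.exists_norm_le
    refine ne_top_of_le_ne_top (b := ENNReal.ofReal B) ENNReal.ofReal_ne_top (iSup_le fun w => ?_)
    rw [← ofReal_norm]
    exact ENNReal.ofReal_le_ofReal (hB _ ⟨w, rfl⟩)
  · refine ne_top_of_le_ne_top (b := (C : ℝ≥0∞)) ENNReal.coe_ne_top ?_
    rw [lipSemi_le_iff]
    intro v w _
    rw [← edist_eq_enorm_sub]
    exact ENNReal.div_le_of_le_mul (hf v w)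

/-- The space `L(W)` of complex-valued Lipschitz functions, normed by `‖f‖_L`. -/
def LipFun (W : Type*) [MetricSpace W] : Type _ := lipSubmodule W

namespace LipFun

variable {W : Type*} [MetricSpace W]

instance : AddCommGroup (LipFun W) := inferInstanceAs (AddCommGroup (lipSubmodule W))
instance : Module ℂ (LipFun W) := inferInstanceAs (Module ℂ (lipSubmodule W))
instance : CoeFun (LipFun W) (fun _ => W → ℂ) := ⟨fun f => f.1⟩
instance : Norm (LipFun W) := ⟨fun f => (lipNorm f.1).toReal⟩

theorem norm_def (f : LipFun W) : ‖f‖ = (lipNorm (f : W → ℂ)).toReal := rfl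

theorem normCore (W : Type*) [MetricSpace W] : NormedSpace.Core ℂ (LipFun W) where
  norm_nonneg _ := ENNReal.toReal_nonneg
  norm_smul c f := by
    change (lipNorm (c • f.1)).toReal = ‖c‖ * (lipNorm f.1).toReal
    rw [lipNorm_smul, ENNReal.toReal_mul, toReal_enorm]
  norm_triangle f g := by
    change (lipNorm (f.1 + g.1)).toReal ≤ (lipNorm f.1).toReal + (lipNorm g.1).toReal
    rw [← ENNReal.toReal_add f.2 g.2]
    exact ENNReal.toReal_mono (ENNReal.add_ne_top.2 ⟨f.2, g.2⟩) (lipNorm_add_le _ _)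
  norm_eq_zero_iff f := by
    constructor
    · intro h
      have h0 : lipNorm f.1 = 0 := ((ENNReal.toReal_eq_zero_iff _).1 h).resolve_right f.2
      refine Subtype.ext (funext fun w => ?_)
      have h1 : supNorm f.1 = 0 := (add_eq_zero.1 h0).1
      have h2 : ‖f.1 w‖ₑ ≤ 0 := h1 ▸ enorm_le_supNorm f.1 w
      exact enorm_eq_zero.1 (nonpos_iff_eq_zero.1 h2)
    · rintro rfl
      change (lipNorm (0 : W → ℂ)).toReal = 0
      simp [lipNorm, supNorm, lipSemi]

instance : NormedAddCommGroup (LipFun W) := NormedAddCommGroup.ofCore (normCore W)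
instance : NormedSpace ℂ (LipFun W) := NormedSpace.ofCore (normCore W)

end LipFun

/-! ## Markov chains and their transition operators -/

/-- The operator `f ↦ ∫ κ(·, dv) f(v)` attached to a family of measures. -/
def markovOp {W : Type*} [MeasurableSpace W] (κ : W → Measure W) (f : W → ℂ) : W → ℂ :=
  fun w => ∫ v, f v ∂(κ w)

/-- `Q_n(w, B) = n⁻¹ ∑_{k=1}^n Q^k(w, B)`; here `Q ^ k` is the `k`-step transition function. -/
def cesaro {W : Type*} [MeasurableSpace W] (Q : Kernel W W) (n : ℕ) (w : W) : Measure W :=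
  (n : ℝ≥0∞)⁻¹ • ∑ k ∈ Finset.Icc 1 n, (Q ^ k) w

section Chains

variable {W : Type*} [MetricSpace W] [MeasurableSpace W]

/-- The operators attached to `κ n`, `n ≥ 1`, act as bounded operators on `L(W)` and converge to
`Uinf` in the operator norm of `L(W)`. -/
def ConvergesOnLip (κ : ℕ → W → Measure W) (Uinf : LipFun W →L[ℂ] LipFun W) : Prop :=
  ∃ V : ℕ → LipFun W →L[ℂ] LipFun W,
    (∀ n, 1 ≤ n → ∀ (f : LipFun W) (w : W), V n f w = markovOp (κ n) f w) ∧
    Tendsto (fun n => ‖V n - Uinf‖) atTop (𝓝 0)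

/-- The transition operator of `Q` is orderly with respect to `L(W)`. -/
def IsOrderly (Q : Kernel W W) : Prop :=
  ∃ Uinf : LipFun W →L[ℂ] LipFun W, ConvergesOnLip (fun n => cesaro Q n) Uinf

/-- The transition operator of `Q` is aperiodic with respect to `L(W)`. -/
def IsAperiodic (Q : Kernel W W) : Prop :=
  ∃ Uinf : LipFun W →L[ℂ] LipFun W, ConvergesOnLip (fun n => ⇑(Q ^ n)) Uinf

/-- The transition operator of `Q` is ergodic with respect to `L(W)`: it is orderly and the limit
operator has one-dimensional range. -/
def IsErgodic (Q : Kernel W W) : Prop :=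
  ∃ Uinf : LipFun W →L[ℂ] LipFun W, ConvergesOnLip (fun n => cesaro Q n) Uinf ∧
    Module.finrank ℂ (LinearMap.range (Uinf : LipFun W →ₗ[ℂ] LipFun W)) = 1

/-- The transition operator of `Q` is regular with respect to `L(W)`. -/
def IsRegularOnLip (Q : Kernel W W) : Prop :=
  IsErgodic Q ∧ IsAperiodic Q

/-- The transition operator `U` of `Q` is a Doeblin-Fortet operator: it is a bounded operator on
`L(W)` and `s(U^k f) ≤ r s(f) + R ‖f‖` for some `k ≥ 1`, `r < 1` and `R < ∞`. -/
def IsDoeblinFortet (Q : Kernel W W) : Prop :=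
  (∃ V : LipFun W →L[ℂ] LipFun W, ∀ (f : LipFun W) (w : W), V f w = markovOp Q f w) ∧
  ∃ (k : ℕ) (r R : ℝ≥0), 1 ≤ k ∧ r < 1 ∧
    ∀ f : LipFun W,
      lipSemi ((markovOp Q)^[k] f) ≤ r * lipSemi (f : W → ℂ) + R * supNorm (f : W → ℂ)

end Chains

/-! ## Random systems with complete connections -/

/-- A homogeneous random system with complete connections
`{(W, 𝓦), (X, 𝓧), u, P}`. -/
structure RSCC (W X : Type*) [MeasurableSpace W] [MeasurableSpace X] where
  u : W × X → W
  measurable_u : Measurable u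
  P : Kernel W X
  isMarkovKernel_P : IsMarkovKernel P

namespace RSCC

variable {W X : Type*} [MeasurableSpace W] [MeasurableSpace X]

instance (S : RSCC W X) : IsMarkovKernel S.P := S.isMarkovKernel_P

/-- The maps `u^(n) : W × X^n → W`, `u^(n) (w, x) = w x_1 ⋯ x_n`. -/
def path (S : RSCC W X) : (n : ℕ) → W → (Fin n → X) → W
  | 0, w, _ => w
  | n + 1, w, x => S.u (S.path n w (fun i => x i.castSucc), x (Fin.last n))

theorem measurable_path (S : RSCC W X) (n : ℕ) :
    Measurable (fun p : W × (Fin n → X) => S.path n p.1 p.2) := by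
  induction n with
  | zero => exact measurable_fst
  | succ n ih =>
    refine S.measurable_u.comp (Measurable.prodMk ?_ ?_)
    · exact ih.comp (measurable_fst.prodMk
        (measurable_pi_lambda _ fun i => (measurable_pi_apply _).comp measurable_snd))
    · exact (measurable_pi_apply _).comp measurable_snd

/-- Appending a last coordinate, `(x_1, …, x_n), y ↦ (x_1, …, x_n, y)`. -/
def append (X : Type*) (n : ℕ) (p : (Fin n → X) × X) : Fin (n + 1) → X :=
  Fin.snoc (α := fun _ => X) p.1 p.2

theorem measurable_append (n : ℕ) : Measurable (append X n) := by
  refine measurable_pi_lambda _ fun i => ?_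
  refine Fin.lastCases ?_ (fun j => ?_) i
  · simpa [append] using measurable_snd
  · simpa [append, Function.comp_def] using
      (measurable_pi_apply j).comp (measurable_fst (α := Fin n → X) (β := X))

/-- The transition functions `P_n` from `W` to `X^n`:
`P_n(w, A) = ∫ P(w, dx_1) ∫ P(w x_1, dx_2) ⋯ ∫ P(w x^(n-1), dx_n) 1_A(x_1, …, x_n)`. -/
def Pn (S : RSCC W X) : (n : ℕ) → Kernel W (Fin n → X)
  | 0 => Kernel.deterministic (fun _ => Fin.elim0) measurable_const
  | n + 1 => (S.Pn n ⊗ₖ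
      S.P.comap (fun p : W × (Fin n → X) => S.path n p.1 p.2) (S.measurable_path n)).map
        (append X n)

instance isMarkovKernel_Pn (S : RSCC W X) (n : ℕ) : IsMarkovKernel (S.Pn n) := by
  induction n with
  | zero => unfold Pn; infer_instance
  | succ n ih => unfold Pn; exact Kernel.IsMarkovKernel.map _ (measurable_append n)

/-- The transition function of the associated Markov chain,
`Q(w, B) = P(w, {x | w x ∈ B})`. -/
def Q (S : RSCC W X) : Kernel W W where
  toFun w := (S.P w).map (fun x => S.u (w, x))
  measurable' := by
    have h : (fun w => (S.P w).map (fun x => S.u (w, x))) = (Kernel.id ×ₖ S.P).map S.u := by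
      funext w
      rw [Kernel.map_apply _ S.measurable_u, Kernel.prod_apply, Kernel.id_apply,
        Measure.dirac_prod, Measure.map_map S.measurable_u measurable_prodMk_left]
      rfl
    rw [h]
    exact Kernel.measurable _

/-- `r_j = sup_{w' ≠ w''} ∫ P_j(w', dx) d(w'x, w''x) / d(w', w'')`. -/
def r {W : Type*} [MetricSpace W] [MeasurableSpace W] (S : RSCC W X) (j : ℕ) : ℝ≥0∞ :=
  ⨆ (w' : W) (w'' : W) (_ : w' ≠ w''),
    ∫⁻ x, edist (S.path j w' x) (S.path j w'' x) / edist w' w'' ∂(S.Pn j w')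

/-- `R_j = sup_A s(P_j(·, A))`. -/
def R {W : Type*} [MetricSpace W] [MeasurableSpace W] (S : RSCC W X) (j : ℕ) : ℝ≥0∞ :=
  ⨆ (A : Set (Fin j → X)) (_ : MeasurableSet A), lipSemi (fun w => (S.Pn j w).real A)

/-- The random system is with contraction. -/
def WithContraction {W : Type*} [MetricSpace W] [MeasurableSpace W] (S : RSCC W X) : Prop :=
  TopologicalSpace.SeparableSpace W ∧ S.r 1 < ⊤ ∧ S.R 1 < ⊤ ∧ ∃ j, 1 ≤ j ∧ S.r j < 1

end RSCC

/-! ## The system attached to `θ`-expansions -/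

/-- `P_i(s) = (sθ + 1) / ((s + iθ)(s + (i+1)θ))`. -/
def thetaP (θ : ℝ) (i : ℕ) (s : ℝ) : ℝ :=
  (s * θ + 1) / ((s + i * θ) * (s + (i + 1) * θ))

theorem thetaP_nonneg {θ : ℝ} (hθ : 0 < θ) (i : ℕ) {s : ℝ} (hs : 0 ≤ s) : 0 ≤ thetaP θ i s := by
  unfold thetaP; positivity

theorem one_le_of_theta {m : ℕ} {θ : ℝ} (hθ : 0 < θ) (hm : θ ^ 2 = 1 / m) : 1 ≤ m := by
  rcases Nat.eq_zero_or_pos m with rfl | h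
  · have := pow_pos hθ 2
    simp at hm
    simp [hm] at this
  · exact h

theorem mul_sq_theta {m : ℕ} {θ : ℝ} (hθ : 0 < θ) (hm : θ ^ 2 = 1 / m) : (m : ℝ) * θ ^ 2 = 1 := by
  have : (m : ℝ) ≠ 0 := by have := one_le_of_theta hθ hm; positivity
  rw [hm]; field_simp

theorem hasSum_thetaP {m : ℕ} {θ : ℝ} (hθ : 0 < θ) (hm : θ ^ 2 = 1 / m) {s : ℝ} (hs : 0 ≤ s) :
    HasSum (fun k : ℕ => thetaP θ (m + k) s) 1 := by
  have hmpos : (0 : ℝ) < m := by have := one_le_of_theta hθ hm; positivity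
  have hmul := mul_sq_theta hθ hm
  rw [hasSum_iff_tendsto_nat_of_nonneg (fun k => thetaP_nonneg hθ _ hs)]
  have hsum : ∀ n : ℕ, ∑ k ∈ Finset.range n, thetaP θ (m + k) s
      = 1 - (s * θ + 1) / θ * (s + (m + n) * θ)⁻¹ := by
    intro n
    induction n with
    | zero =>
      have h : s + (m : ℝ) * θ = (s * θ + 1) / θ := by
        field_simp
        linarith
      have h' : (s * θ + 1) / θ ≠ 0 := by positivity
      simp only [Finset.range_zero, Finset.sum_empty, Nat.cast_zero, add_zero]
      rw [h, mul_inv_cancel₀ h', sub_self]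
    | succ n ih =>
      rw [Finset.sum_range_succ, ih, thetaP]
      have h1 : s + ((m : ℝ) + n) * θ ≠ 0 := by positivity
      have h2 : s + ((m : ℝ) + n + 1) * θ ≠ 0 := by positivity
      have h3 : s + ((m : ℝ) + (n + 1)) * θ ≠ 0 := by positivity
      push_cast
      field_simp
      ring
  simp_rw [hsum]
  have hlin : Tendsto (fun n : ℕ => s + ((m : ℝ) + n) * θ) atTop atTop :=
    tendsto_atTop_add_const_left _ _ ((tendsto_atTop_add_const_left _ _
      tendsto_natCast_atTop_atTop).atTop_mul_const hθ)
  simpa using ((tendsto_inv_atTop_zero.comp hlin).const_mul ((s * θ + 1) / θ)).const_sub 1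

/-- The map `(s, i) ↦ u_i(s) = 1 / (s + iθ)` of `[0, θ] × {m, m+1, …}` into `[0, θ]`. -/
def thetaMap (m : ℕ) (θ : ℝ) (hθ : 0 < θ) (hm : θ ^ 2 = 1 / m)
    (p : Set.Icc (0 : ℝ) θ × Set.Ici m) : Set.Icc (0 : ℝ) θ :=
  ⟨1 / ((p.1 : ℝ) + (p.2 : ℕ) * θ), by
    obtain ⟨⟨s, hs0, hs1⟩, ⟨i, hi⟩⟩ := p
    have hi' : (m : ℝ) ≤ i := by exact_mod_cast hi
    have hmpos : (0 : ℝ) < m := by have := one_le_of_theta hθ hm; positivity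
    have hpos : 0 < s + i * θ := by
      have : 0 < (i : ℝ) := by linarith
      positivity
    refine ⟨by positivity, ?_⟩
    rw [div_le_iff₀ hpos]
    nlinarith [mul_sq_theta hθ hm, mul_nonneg hθ.le hs0,
      mul_le_mul_of_nonneg_right hi' (sq_nonneg θ)]⟩

theorem measurable_thetaMap (m : ℕ) (θ : ℝ) (hθ : 0 < θ) (hm : θ ^ 2 = 1 / m) :
    Measurable (thetaMap m θ hθ hm) := by
  refine Measurable.subtype_mk ?_
  have h2 : Measurable fun p : Set.Icc (0 : ℝ) θ × Set.Ici m => (((p.2 : ℕ) : ℝ)) :=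
    (measurable_from_top (f := fun n : ℕ => (n : ℝ))).comp
      (measurable_subtype_coe.comp measurable_snd)
  exact measurable_const.div ((measurable_subtype_coe.comp measurable_fst).add
    (h2.mul_const θ))

/-- The transition function `P(s, {i}) = P_i(s)` from `[0, θ]` to `{m, m+1, …}`. -/
def thetaKernel (m : ℕ) (θ : ℝ) : Kernel (Set.Icc (0 : ℝ) θ) (Set.Ici m) where
  toFun s := Measure.sum fun i : Set.Ici m => ENNReal.ofReal (thetaP θ i s) • Measure.dirac i
  measurable' := by
    refine Measure.measurable_of_measurable_coe _ fun A hA => ?_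
    simp only [Measure.sum_apply _ hA, Measure.smul_apply, smul_eq_mul]
    refine Measurable.tsum fun i => Measurable.mul_const ?_ _
    unfold thetaP
    fun_prop

theorem isMarkovKernel_thetaKernel {m : ℕ} {θ : ℝ} (hθ : 0 < θ) (hm : θ ^ 2 = 1 / m) :
    IsMarkovKernel (thetaKernel m θ) := by
  refine ⟨fun s => ⟨?_⟩⟩
  change (Measure.sum fun i : Set.Ici m =>
    ENNReal.ofReal (thetaP θ i s) • Measure.dirac i) Set.univ = 1
  rw [Measure.sum_apply _ MeasurableSet.univ]
  simp only [Measure.smul_apply, measure_univ, smul_eq_mul, mul_one]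
  let e : ℕ ≃ Set.Ici m :=
    { toFun := fun k => ⟨m + k, Nat.le_add_right m k⟩
      invFun := fun i => i.1 - m
      left_inv := fun k => by simp
      right_inv := fun i => Subtype.ext (Nat.add_sub_cancel' i.2) }
  rw [← e.tsum_eq]
  have h := hasSum_thetaP hθ hm s.2.1
  have h' := ENNReal.ofReal_tsum_of_nonneg
    (fun k => thetaP_nonneg hθ (m + k) s.2.1) h.summable
  rw [h.tsum_eq, ENNReal.ofReal_one] at h'
  exact h'.symm

/-- The random system with complete connections of the `θ`-expansion, `θ² = 1/m`. -/
def thetaRSCC (m : ℕ) (θ : ℝ) (hθ : 0 < θ) (hm : θ ^ 2 = 1 / m) :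
    RSCC (Set.Icc (0 : ℝ) θ) (Set.Ici m) where
  u := thetaMap m θ hθ hm
  measurable_u := measurable_thetaMap m θ hθ hm
  P := thetaKernel m θ
  isMarkovKernel_P := isMarkovKernel_thetaKernel hθ hm

/-- `γ_θ(A) = (1 / log(1 + θ²)) ∫_A θ dx / (1 + θx)` for Borel `A ⊆ [0, θ]`. -/
def gammaTheta (θ : ℝ) : Measure (Set.Icc (0 : ℝ) θ) :=
  ENNReal.ofReal (1 / Real.log (1 + θ ^ 2)) •
    (Measure.comap Subtype.val (volume : Measure ℝ)).withDensity
      (fun x => ENNReal.ofReal (θ / (1 + θ * (x : ℝ))))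

end

/-! One step of the chain already shrinks the Lipschitz seminorm: `s(Uf) ≤ (3/2) θ² s(f)`. Two
effects add up. Each `u_i` is `θ²`-Lipschitz, because `s + iθ ≥ mθ = 1/θ`; this gives `θ² s(f)`. The
weights satisfy `|P_i(w) - P_i(v)| ≤ θ (w - v) P_i(v)` for `v ≤ w`, so their total variation is at
most `θ |w - v|`. As `f` may be replaced by `f - f(θ/2)`, which is bounded by `s(f) θ/2`, the second
effect costs only `θ²/2 · s(f)`. Since `θ < 1` forces `m ≥ 2`, the factor is at most `3/4`
(`contractsLip_thetaQ`, `two_mul_sq_theta_le_one`).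

The measure `γ_θ` is invariant because its density `ρ` satisfies `ρ(u_i(s)) |u_i'(s)| = ρ(s) P_i(s)`
and the images `u_i([0, θ))` tile `(0, θ]` (`lintegral_thetaP_mul`, `iUnion_image_inv_add`,
`invariant_gammaTheta`).

The rest is general. Invariance gives `U^n f(w) - ∫ f dμ = ∫ (U^n f(w) - U^n f(x)) μ(dx)`, which the
seminorm contraction and the finite diameter make geometrically small
(`norm_lipOp_pow_apply_sub_le`). Operator-norm convergence, its Cesàro version and hence regularity
follow. -/

/-! ### The Lipschitz seminorm and the space `L(W)` -/

theorem lipSemi_le_coe_iff {W E : Type*} [MetricSpace W] [NormedAddCommGroup E] {f : W → E}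
    {K : ℝ≥0} : lipSemi f ≤ K ↔ LipschitzWith K f := by
  rw [lipSemi_le_iff]
  constructor
  · intro h v w
    rcases eq_or_ne v w with rfl | hvw
    · simp
    · rw [edist_eq_enorm_sub]
      exact (ENNReal.div_le_iff (edist_pos.2 hvw).ne' (edist_ne_top v w)).1 (h v w hvw)
  · intro h v w hvw
    rw [ENNReal.div_le_iff (edist_pos.2 hvw).ne' (edist_ne_top v w), ← edist_eq_enorm_sub]
    exact h v w

theorem supNorm_le_ofReal {W E : Type*} [NormedAddCommGroup E] {f : W → E} {C : ℝ}
    (h : ∀ w, ‖f w‖ ≤ C) : supNorm f ≤ ENNReal.ofReal C :=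
  iSup_le fun w => by
    rw [← ofReal_norm]
    exact ENNReal.ofReal_le_ofReal (h w)

theorem lipSemi_sub_const {W E : Type*} [MetricSpace W] [NormedAddCommGroup E] (f : W → E)
    (c : E) : lipSemi (fun w => f w - c) = lipSemi f := by
  simp [lipSemi]

theorem lipSemi_const {W E : Type*} [MetricSpace W] [NormedAddCommGroup E]
    (c : E) : lipSemi (fun _ : W => c) = 0 := by
  simp [lipSemi]

namespace LipFun

variable {W : Type*} [MetricSpace W]

@[ext]
theorem ext {f g : LipFun W} (h : ∀ w, f w = g w) : f = g :=
  Subtype.ext (funext h)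

theorem add_apply (f g : LipFun W) (w : W) : (f + g) w = f w + g w := rfl
theorem sub_apply (f g : LipFun W) (w : W) : (f - g) w = f w - g w := rfl
theorem smul_apply (c : ℂ) (f : LipFun W) (w : W) : (c • f) w = c * f w := rfl

theorem sum_apply {ι : Type*} (s : Finset ι) (f : ι → LipFun W) (w : W) :
    (∑ i ∈ s, f i) w = ∑ i ∈ s, f i w := by
  classical
  induction s using Finset.induction_on with
  | empty => rfl
  | insert a s ha ih => rw [Finset.sum_insert ha, Finset.sum_insert ha, add_apply, ih]

/-- The Lipschitz seminorm of an element of `L(W)`, as a real number. -/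
noncomputable def lipConst (f : LipFun W) : ℝ≥0 := (lipSemi (f : W → ℂ)).toNNReal

theorem lipSemi_ne_top (f : LipFun W) : lipSemi (f : W → ℂ) ≠ ⊤ :=
  ne_top_of_le_ne_top f.2 le_add_self

theorem supNorm_ne_top (f : LipFun W) : supNorm (f : W → ℂ) ≠ ⊤ :=
  ne_top_of_le_ne_top f.2 le_self_add

theorem coe_lipConst (f : LipFun W) : (f.lipConst : ℝ≥0∞) = lipSemi (f : W → ℂ) :=
  ENNReal.coe_toNNReal f.lipSemi_ne_top

theorem lipschitzWith (f : LipFun W) : LipschitzWith f.lipConst (f : W → ℂ) :=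
  lipSemi_le_coe_iff.1 f.coe_lipConst.ge

theorem norm_eq (f : LipFun W) : ‖f‖ = (supNorm (f : W → ℂ)).toReal + f.lipConst := by
  rw [norm_def, lipNorm, ENNReal.toReal_add f.supNorm_ne_top f.lipSemi_ne_top, ← coe_lipConst]
  rfl

theorem lipConst_le_norm (f : LipFun W) : (f.lipConst : ℝ) ≤ ‖f‖ := by
  rw [norm_eq]
  exact le_add_of_nonneg_left ENNReal.toReal_nonneg

theorem norm_apply_le (f : LipFun W) (w : W) : ‖f w‖ ≤ (supNorm (f : W → ℂ)).toReal := by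
  rw [← toReal_enorm]
  exact ENNReal.toReal_mono f.supNorm_ne_top (enorm_le_supNorm _ w)

theorem norm_apply_le_norm (f : LipFun W) (w : W) : ‖f w‖ ≤ ‖f‖ := by
  rw [norm_eq]
  exact (f.norm_apply_le w).trans (le_add_of_nonneg_right f.lipConst.coe_nonneg)

theorem lipNorm_eq_ofReal_norm (f : LipFun W) :
    lipNorm (f : W → ℂ) = ENNReal.ofReal ‖f‖ := by
  rw [norm_def, ENNReal.ofReal_toReal f.2]

theorem norm_le_of_le {f : LipFun W} {A : ℝ} {B : ℝ≥0} (hA0 : 0 ≤ A) (hA : ∀ w, ‖f w‖ ≤ A)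
    (hB : LipschitzWith B (f : W → ℂ)) : ‖f‖ ≤ A + B := by
  rw [norm_eq]
  refine add_le_add ?_ ?_
  · exact ENNReal.toReal_le_of_le_ofReal hA0 (supNorm_le_ofReal hA)
  · have h : (f.lipConst : ℝ≥0∞) ≤ B := f.coe_lipConst.trans_le (lipSemi_le_coe_iff.2 hB)
    exact_mod_cast h

theorem integrable [MeasurableSpace W] [BorelSpace W] (f : LipFun W) (μ : Measure W)
    [IsFiniteMeasure μ] : Integrable (f : W → ℂ) μ :=
  Integrable.of_bound f.lipschitzWith.continuous.measurable.aestronglyMeasurable _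
    (ae_of_all _ f.norm_apply_le_norm)

/-- A constant function as an element of `L(W)`. -/
noncomputable def const (W : Type*) [MetricSpace W] (c : ℂ) : LipFun W :=
  ⟨fun _ => c, by
    change lipNorm _ ≠ ⊤
    rw [lipNorm, lipSemi_const, add_zero]
    exact ne_top_of_le_ne_top (b := ‖c‖ₑ) enorm_ne_top (iSup_le fun _ => le_rfl)⟩

theorem const_apply (c : ℂ) (w : W) : const W c w = c := rfl

theorem norm_const_le (c : ℂ) : ‖const W c‖ ≤ ‖c‖ := by
  simpa using norm_le_of_le (norm_nonneg c) (fun w => (le_refl ‖const W c w‖))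
    (LipschitzWith.const c : LipschitzWith 0 (const W c : W → ℂ))

/-- The operator `f ↦ ∫ f dμ` from `L(W)` to the constant functions. -/
noncomputable def integralConst [MeasurableSpace W] [BorelSpace W] (μ : Measure W)
    [IsProbabilityMeasure μ] : LipFun W →L[ℂ] LipFun W :=
  LinearMap.mkContinuous
    { toFun := fun f => const W (∫ x, f x ∂μ)
      map_add' := fun f g => by
        ext w
        exact integral_add (f.integrable μ) (g.integrable μ)
      map_smul' := fun c f => by
        ext w
        exact integral_const_mul c f.1 }
    1 (fun f => by
      rw [one_mul]
      refine (norm_const_le _).trans ?_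
      simpa using norm_integral_le_of_norm_le_const (μ := μ) (ae_of_all _ f.norm_apply_le_norm))

theorem integralConst_apply [MeasurableSpace W] [BorelSpace W] (μ : Measure W)
    [IsProbabilityMeasure μ] (f : LipFun W) (w : W) :
    integralConst μ f w = ∫ x, f x ∂μ := rfl

/-- The range consists of the constants, spanned by `1`; each constant is attained because `μ` has
mass one, and `W` is nonempty because it carries `μ`. -/
theorem finrank_range_integralConst [MeasurableSpace W] [BorelSpace W] (μ : Measure W)
    [IsProbabilityMeasure μ] :
    Module.finrank ℂ
      (LinearMap.range (integralConst μ : LipFun W →ₗ[ℂ] LipFun W)) = 1 := by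
  have : Nonempty W := nonempty_of_isProbabilityMeasure μ
  have hne : const W 1 ≠ 0 := by
    intro h
    have h1 : const W 1 (Classical.arbitrary W) = (0 : LipFun W) (Classical.arbitrary W) := by
      rw [h]
    exact one_ne_zero (α := ℂ) h1
  have hrange : LinearMap.range (integralConst μ : LipFun W →ₗ[ℂ] LipFun W)
      = Submodule.span ℂ {const W 1} := by
    ext g
    rw [Submodule.mem_span_singleton, LinearMap.mem_range]
    constructor
    · rintro ⟨f, rfl⟩
      refine ⟨∫ x, f x ∂μ, ?_⟩
      ext w
      exact mul_one _
    · rintro ⟨c, rfl⟩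
      refine ⟨const W c, ?_⟩
      ext w
      change ∫ _, c ∂μ = c * 1
      simp
  rw [hrange, finrank_span_singleton hne]

end LipFun

/-! ### Transition operators that contract the Lipschitz seminorm -/

section MarkovOperators

theorem norm_markovOp_le {W : Type*} [MeasurableSpace W] {κ : W → Measure W}
    [∀ w, IsProbabilityMeasure (κ w)] {f : W → ℂ}
    {C : ℝ} (hf : ∀ w, ‖f w‖ ≤ C) (w : W) : ‖markovOp κ f w‖ ≤ C := by
  exact (norm_integral_le_of_norm_le_const (μ := κ w) (ae_of_all _ hf)).trans (by simp)

variable {W : Type*} [MetricSpace W] [MeasurableSpace W]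

/-- The transition operator of `Q` shrinks Lipschitz constants by the factor `c`. -/
def ContractsLip (Q : Kernel W W) (c : ℝ≥0) : Prop :=
  ∀ (K : ℝ≥0) (f : W → ℂ), LipschitzWith K f → LipschitzWith (c * K) (markovOp Q f)

variable [BorelSpace W] {Q : Kernel W W} [IsMarkovKernel Q] {c : ℝ≥0}

/-- The transition operator of a kernel which contracts Lipschitz constants, acting on `L(W)`. -/
noncomputable def lipOp (hQ : ContractsLip Q c) : LipFun W →L[ℂ] LipFun W :=
  LinearMap.mkContinuous
    { toFun := fun f => ⟨markovOp Q f, ENNReal.add_ne_top.2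
        ⟨ne_top_of_le_ne_top ENNReal.ofReal_ne_top
          (supNorm_le_ofReal (norm_markovOp_le f.norm_apply_le)),
        ne_top_of_le_ne_top ENNReal.coe_ne_top
          (lipSemi_le_coe_iff.2 (hQ _ _ f.lipschitzWith))⟩⟩
      map_add' := fun f g => by
        ext w
        exact integral_add (f.integrable (Q w)) (g.integrable (Q w))
      map_smul' := fun a f => by
        ext w
        exact integral_const_mul a f.1 }
    (1 + c) (fun f => by
      rw [add_mul, one_mul]
      refine (LipFun.norm_le_of_le (norm_nonneg f)
        (norm_markovOp_le f.norm_apply_le_norm) (hQ _ _ f.lipschitzWith)).trans ?_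
      rw [NNReal.coe_mul]
      exact add_le_add le_rfl (mul_le_mul_of_nonneg_left f.lipConst_le_norm c.coe_nonneg))

theorem lipOp_apply (hQ : ContractsLip Q c) (f : LipFun W) (w : W) :
    lipOp hQ f w = markovOp Q f w := rfl

instance isMarkovKernel_pow (n : ℕ) : IsMarkovKernel (Q ^ n) := by
  induction n with
  | zero => exact inferInstanceAs (IsMarkovKernel (Kernel.id : Kernel W W))
  | succ n ih =>
    rw [pow_succ]
    exact inferInstanceAs (IsMarkovKernel ((Q ^ n) ∘ₖ Q))

theorem lipOp_pow_apply (hQ : ContractsLip Q c) (n : ℕ) (f : LipFun W) (w : W) :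
    (lipOp hQ ^ n) f w = markovOp (Q ^ n) f w := by
  induction n generalizing w with
  | zero =>
    change f w = ∫ v, f v ∂((Kernel.id : Kernel W W) w)
    rw [Kernel.id_apply, integral_dirac' _ _ f.lipschitzWith.continuous.stronglyMeasurable]
  | succ n ih =>
    -- The two powers are unfolded on opposite sides: `Q^n ∘ₖ Q` takes its first step by `Q`, which
    -- corresponds to applying `U` last, to `U^n f`.
    rw [pow_succ', mul_apply_eq_comp, lipOp_apply, pow_succ]
    change _ = ∫ v, f v ∂(((Q ^ n) ∘ₖ Q) w)
    rw [Kernel.integral_comp (f.integrable _)]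
    exact integral_congr_ae (ae_of_all _ ih)

theorem lipschitzWith_lipOp_pow (hQ : ContractsLip Q c) (n : ℕ) (f : LipFun W) :
    LipschitzWith (c ^ n * f.lipConst) ((lipOp hQ ^ n) f : W → ℂ) := by
  induction n with
  | zero => simpa using f.lipschitzWith
  | succ n ih =>
    have h : (lipOp hQ ^ (n + 1)) f = lipOp hQ ((lipOp hQ ^ n) f) := by
      rw [pow_succ', mul_apply_eq_comp]
    rw [h, pow_succ', mul_assoc]
    exact hQ _ _ ih

theorem integral_lipOp_pow (hQ : ContractsLip Q c) {μ : Measure W} [IsProbabilityMeasure μ]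
    (hμ : Kernel.Invariant Q μ) (n : ℕ) (f : LipFun W) :
    ∫ x, (lipOp hQ ^ n) f x ∂μ = ∫ x, f x ∂μ := by
  have : Nonempty W := nonempty_of_isProbabilityMeasure μ
  induction n with
  | zero => simp
  | succ n ih =>
    rw [pow_succ', mul_apply_eq_comp, ← ih]
    -- Viewing `μ` as a constant kernel turns invariance into an identity of composed kernels, so
    -- the same Fubini rule applies.
    have h := Kernel.integral_comp (η := Q) (κ := Kernel.const W μ) (a := Classical.arbitrary W)
      (LipFun.integrable ((lipOp hQ ^ n) f) _)
    rw [hμ.comp_const, Kernel.const_apply] at h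
    exact h.symm

/-- By invariance, `∫ f dμ` is the `μ`-average of `U^n f`. A function with Lipschitz constant `c^n
s(f)` differs from its average by at most `c^n s(f) D`, and subtracting a constant leaves the
seminorm unchanged; the two parts of the norm give the factor `1 + D`. -/
theorem norm_lipOp_pow_apply_sub_le (hQ : ContractsLip Q c) {μ : Measure W}
    [IsProbabilityMeasure μ] (hμ : Kernel.Invariant Q μ) {D : ℝ} (hD : ∀ v w : W, dist v w ≤ D)
    (n : ℕ) (f : LipFun W) :
    ‖(lipOp hQ ^ n) f - LipFun.integralConst μ f‖ ≤ (1 + D) * c ^ n * ‖f‖ := by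
  set g := (lipOp hQ ^ n) f with hg
  have hlip := lipschitzWith_lipOp_pow hQ n f
  have : Nonempty W := nonempty_of_isProbabilityMeasure μ
  have hD0 : 0 ≤ D := dist_nonneg.trans (hD (Classical.arbitrary W) (Classical.arbitrary W))
  have hsup : ∀ w, ‖(g - LipFun.integralConst μ f) w‖ ≤ c ^ n * f.lipConst * D := by
    intro w
    have h1 : (g - LipFun.integralConst μ f) w = ∫ x, (g w - g x) ∂μ := by
      rw [LipFun.sub_apply, LipFun.integralConst_apply, ← integral_lipOp_pow hQ hμ n f,
        integral_sub (integrable_const _) (g.integrable μ)]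
      simp [hg]
    rw [h1]
    refine (norm_integral_le_of_norm_le_const (μ := μ)
      (C := c ^ n * f.lipConst * D) (ae_of_all _ fun x => ?_)).trans (by simp)
    rw [← dist_eq_norm]
    refine (hlip.dist_le_mul w x).trans ?_
    push_cast
    exact mul_le_mul_of_nonneg_left (hD w x) (by positivity)
  have hlip' : LipschitzWith (c ^ n * f.lipConst)
      ((g - LipFun.integralConst μ f : LipFun W) : W → ℂ) := by
    rw [← lipSemi_le_coe_iff] at hlip ⊢
    exact (lipSemi_sub_const (g : W → ℂ) (∫ x, f x ∂μ)).trans_le hlip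
  refine (LipFun.norm_le_of_le (by positivity) hsup hlip').trans ?_
  push_cast
  calc (c : ℝ) ^ n * f.lipConst * D + c ^ n * f.lipConst
      = (1 + D) * c ^ n * f.lipConst := by ring
    _ ≤ _ := mul_le_mul_of_nonneg_left f.lipConst_le_norm (by positivity)

theorem isDoeblinFortet_of_contractsLip (hQ : ContractsLip Q c) (hc : c < 1) :
    IsDoeblinFortet Q := by
  -- A strict contraction of the seminorm in one step needs no sup-norm term, so `k = 1` and `R =
  -- 0`.
  refine ⟨⟨lipOp hQ, lipOp_apply hQ⟩, 1, c, 0, le_rfl, hc, fun f => ?_⟩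
  rw [Function.iterate_one, ENNReal.coe_zero, zero_mul, add_zero, ← f.coe_lipConst,
    ← ENNReal.coe_mul]
  exact lipSemi_le_coe_iff.2 (hQ _ _ f.lipschitzWith)

theorem tendsto_lipOp_pow (hQ : ContractsLip Q c) (hc : c < 1) {μ : Measure W}
    [IsProbabilityMeasure μ] (hμ : Kernel.Invariant Q μ) {D : ℝ}
    (hD : ∀ v w : W, dist v w ≤ D) :
    Tendsto (fun n => lipOp hQ ^ n) atTop (𝓝 (LipFun.integralConst μ)) := by
  have : Nonempty W := nonempty_of_isProbabilityMeasure μ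
  have hD0 : 0 ≤ D := dist_nonneg.trans (hD (Classical.arbitrary W) (Classical.arbitrary W))
  rw [tendsto_iff_norm_sub_tendsto_zero]
  refine squeeze_zero (fun _ => norm_nonneg _) (g := fun n => (1 + D) * (c : ℝ) ^ n)
    (fun n => ?_) ?_
  · exact ContinuousLinearMap.opNorm_le_bound _ (by positivity)
      (norm_lipOp_pow_apply_sub_le hQ hμ hD n)
  · simpa using (tendsto_pow_atTop_nhds_zero_of_lt_one c.coe_nonneg
      (by exact_mod_cast hc)).const_mul (1 + D)

theorem markovOp_cesaro (hQ : ContractsLip Q c) (n : ℕ) (f : LipFun W) (w : W) :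
    ((n : ℂ)⁻¹ • ∑ k ∈ Finset.range n, lipOp hQ ^ (k + 1)) f w
      = markovOp (cesaro Q n) f w := by
  rw [markovOp, cesaro, integral_smul_measure,
    integral_finsetSum_measure (fun i _ => f.integrable _),
    ← Finset.sum_image (s := Finset.range n) (g := fun k => k + 1)
      (f := fun k => lipOp hQ ^ k) (fun _ _ _ _ h => Nat.succ_injective h)]
  have himage : (Finset.range n).image (fun k => k + 1) = Finset.Icc 1 n := by
    ext k
    simp only [Finset.mem_image, Finset.mem_range, Finset.mem_Icc]
    exact ⟨fun ⟨a, ha, h⟩ => by omega, fun h => ⟨k - 1, by omega⟩⟩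
  rw [himage, _root_.smul_apply, LipFun.smul_apply, _root_.sum_apply,
    LipFun.sum_apply]
  simp only [lipOp_pow_apply]
  simp [markovOp]

/-- Aperiodicity is the operator-norm convergence of `U^n`; ergodicity follows because Cesàro means
of a convergent sequence have the same limit. -/
theorem isRegularOnLip_of_contractsLip (hQ : ContractsLip Q c) (hc : c < 1) {μ : Measure W}
    [IsProbabilityMeasure μ] (hμ : Kernel.Invariant Q μ) {D : ℝ}
    (hD : ∀ v w : W, dist v w ≤ D) : IsRegularOnLip Q := by
  have hlim := tendsto_lipOp_pow hQ hc hμ hD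
  refine ⟨⟨LipFun.integralConst μ, ⟨fun n => (n : ℂ)⁻¹ • ∑ k ∈ Finset.range n, lipOp hQ ^ (k + 1),
    fun n _ => markovOp_cesaro hQ n, ?_⟩, LipFun.finrank_range_integralConst μ⟩,
    LipFun.integralConst μ, fun n => lipOp hQ ^ n, fun n _ => lipOp_pow_apply hQ n,
    tendsto_iff_norm_sub_tendsto_zero.1 hlim⟩
  let _ : NormedSpace ℝ (LipFun W →L[ℂ] LipFun W) := NormedSpace.restrictScalars ℝ ℂ _
  -- The averages run over `U^1, …, U^n`, hence the shift by one.
  have h := ((tendsto_add_atTop_iff_nat 1).2 hlim).cesaro_smul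
  refine tendsto_iff_norm_sub_tendsto_zero.1 (h.congr fun n => ?_)
  have : ((n : ℂ)⁻¹) = (((n : ℝ)⁻¹ : ℝ) : ℂ) := by push_cast; rfl
  rw [this]
  rfl

theorem lipNorm_markovOp_pow_sub_le (hQ : ContractsLip Q c) {μ : Measure W}
    [IsProbabilityMeasure μ] (hμ : Kernel.Invariant Q μ) {D : ℝ} (hD : ∀ v w : W, dist v w ≤ D)
    (n : ℕ) (f : LipFun W) :
    lipNorm (fun w => markovOp (Q ^ n) f w - ∫ x, f x ∂μ)
      ≤ ENNReal.ofReal ((1 + D) * c ^ n * ‖f‖) := by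
  have h : (fun w => markovOp (Q ^ n) f w - ∫ x, f x ∂μ)
      = (((lipOp hQ ^ n) f - LipFun.integralConst μ f : LipFun W) : W → ℂ) := by
    funext w
    rw [LipFun.sub_apply, lipOp_pow_apply, LipFun.integralConst_apply]
  rw [h, LipFun.lipNorm_eq_ofReal_norm]
  exact ENNReal.ofReal_le_ofReal (norm_lipOp_pow_apply_sub_le hQ hμ hD n f)

end MarkovOperators

/-! ### Contraction estimates for the `θ`-expansion -/

section ThetaExpansion

variable {m : ℕ} {θ : ℝ}

theorem mul_theta_eq_inv (hθ : 0 < θ) (hm : θ ^ 2 = 1 / m) : (m : ℝ) * θ = 1 / θ := by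
  rw [eq_div_iff hθ.ne', ← mul_sq_theta hθ hm]
  ring

theorem inv_theta_le {i : ℕ} (hθ : 0 < θ) (hm : θ ^ 2 = 1 / m) (hi : m ≤ i) {s : ℝ}
    (hs : 0 ≤ s) : 1 / θ ≤ s + i * θ := by
  rw [← mul_theta_eq_inv hθ hm]
  have : (m : ℝ) * θ ≤ i * θ := mul_le_mul_of_nonneg_right (by exact_mod_cast hi) hθ.le
  linarith

/-- The case `m = 1` would mean `θ = 1`; hence `m ≥ 2`. -/
theorem two_mul_sq_theta_le_one (hθ : 0 < θ) (hθ1 : θ < 1) (hm : θ ^ 2 = 1 / m) :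
    2 * θ ^ 2 ≤ 1 := by
  have h2 : 2 ≤ m := by
    by_contra h
    have h1 : m = 1 := by have := one_le_of_theta hθ hm; omega
    subst h1
    have : θ ^ 2 < 1 := pow_lt_one₀ hθ.le hθ1 two_ne_zero
    simp [hm] at this
  have h2' : (2 : ℝ) ≤ m := by exact_mod_cast h2
  nlinarith [mul_sq_theta hθ hm, sq_nonneg θ]

/-- A bound relative to `P_i(v)` is wanted because it can be summed over `i` using only `∑ P_i(v) =
1`. -/
theorem abs_thetaP_sub_le_of_le {i : ℕ} (hθ : 0 < θ) (hm : θ ^ 2 = 1 / m) (hi : m ≤ i)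
    {v w : ℝ} (hv : 0 ≤ v) (hvw : v ≤ w) :
    |thetaP θ i w - thetaP θ i v| ≤ θ * (w - v) * thetaP θ i v := by
  have hinv := inv_theta_le hθ hm hi hv
  have ha : 0 < v + i * θ := lt_of_lt_of_le (by positivity) hinv
  set a := v + i * θ with ha_def
  set d := w - v with hd_def
  have hd : 0 ≤ d := sub_nonneg.2 hvw
  have hw : w = v + d := by rw [hd_def]; ring
  have h1 : thetaP θ i v = (v * θ + 1) / (a * (a + θ)) := by
    rw [thetaP, ha_def]; ring_nf
  have h2 : thetaP θ i w = ((v + d) * θ + 1) / ((a + d) * (a + d + θ)) := by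
    rw [thetaP, ha_def, hw]; ring_nf
  -- This is `iθ² ≥ mθ² = 1`. It is what lets the growth of the numerator compensate that of the
  -- factor `a` in the denominator.
  have haθ : v * θ + 1 ≤ a * θ := by
    have hi' : (m : ℝ) * θ ≤ i * θ := mul_le_mul_of_nonneg_right (by exact_mod_cast hi) hθ.le
    have := mul_sq_theta hθ hm
    rw [ha_def]
    nlinarith
  have h1θ : 1 ≤ a * θ := by nlinarith
  have hdθ : 0 ≤ d * θ := by positivity
  rw [h1, h2, abs_le]
  have hb : 0 < (a + d) * (a + d + θ) := by positivity
  have hc : 0 < a * (a + θ) := by positivity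
  constructor
  · have key : (1 - θ * d) * ((v * θ + 1) / (a * (a + θ)))
        ≤ ((v + d) * θ + 1) / ((a + d) * (a + d + θ)) := by
      rw [← mul_div_assoc, div_le_div_iff₀ hc hb]
      -- The ratio `P_i(w) / P_i(v)` splits into two factors: `(a + θ) / (a + d + θ) ≥ 1 - θd` by
      -- `e1`, and the remaining one is at least `1` by `e2`.
      have e1 : (1 - θ * d) * (a + θ + d) ≤ a + θ := by
        nlinarith [mul_nonneg hd hθ.le, mul_nonneg hdθ hd, mul_nonneg hdθ hθ.le]
      have e2 : (v * θ + 1) * (a + d) ≤ ((v + d) * θ + 1) * a := by nlinarith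
      calc (1 - θ * d) * (v * θ + 1) * ((a + d) * (a + d + θ))
          = ((1 - θ * d) * (a + θ + d)) * ((v * θ + 1) * (a + d)) := by ring
        _ ≤ (a + θ) * ((v * θ + 1) * (a + d)) :=
            mul_le_mul_of_nonneg_right e1 (by positivity)
        _ ≤ (a + θ) * (((v + d) * θ + 1) * a) := mul_le_mul_of_nonneg_left e2 (by positivity)
        _ = _ := by ring
    linarith
  · have key : ((v + d) * θ + 1) / ((a + d) * (a + d + θ))
        ≤ (1 + θ * d) * ((v * θ + 1) / (a * (a + θ))) := by
      -- For the upper bound the denominator only grows, and the numerator grows by a factor of at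
      -- most `1 + θd`.
      rw [← mul_div_assoc]
      refine div_le_div₀ (by positivity) ?_ hc (mul_le_mul (by linarith) (by linarith)
        (by positivity) (by positivity))
      nlinarith [mul_nonneg hdθ (mul_nonneg hv hθ.le)]
    linarith

theorem abs_inv_sub_inv_theta_le {i : ℕ} (hθ : 0 < θ) (hm : θ ^ 2 = 1 / m) (hi : m ≤ i)
    {v w : ℝ} (hv : 0 ≤ v) (hw : 0 ≤ w) :
    |1 / (v + i * θ) - 1 / (w + i * θ)| ≤ θ ^ 2 * |v - w| := by
  have hv' := inv_theta_le hθ hm hi hv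
  have hw' := inv_theta_le hθ hm hi hw
  have hpos : 0 < 1 / θ := by positivity
  have hv0 := hpos.trans_le hv'
  have hw0 := hpos.trans_le hw'
  have e : 1 / (v + i * θ) - 1 / (w + i * θ) = (w - v) / ((v + i * θ) * (w + i * θ)) := by
    field_simp
    ring
  rw [e, abs_div, abs_of_pos (mul_pos hv0 hw0), div_le_iff₀ (mul_pos hv0 hw0), abs_sub_comm w v]
  have h1 : 1 ≤ θ ^ 2 * ((v + i * θ) * (w + i * θ)) := by
    calc (1 : ℝ) = θ ^ 2 * (1 / θ * (1 / θ)) := by field_simp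
      _ ≤ _ := by gcongr
  calc |v - w| = |v - w| * 1 := (mul_one _).symm
    _ ≤ |v - w| * (θ ^ 2 * ((v + i * θ) * (w + i * θ))) := by gcongr
    _ = _ := by ring

theorem hasSum_thetaP_Ici (hθ : 0 < θ) (hm : θ ^ 2 = 1 / m) {s : ℝ} (hs : 0 ≤ s) :
    HasSum (fun i : Set.Ici m => thetaP θ i s) 1 := by
  let e : ℕ ≃ Set.Ici m :=
    { toFun := fun k => ⟨m + k, Nat.le_add_right m k⟩
      invFun := fun i => i.1 - m
      left_inv := fun k => by simp
      right_inv := fun i => Subtype.ext (Nat.add_sub_cancel' i.2) }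
  exact e.hasSum_iff.1 (hasSum_thetaP hθ hm hs)

theorem thetaKernel_apply (s : Set.Icc (0 : ℝ) θ) :
    thetaKernel m θ s
      = Measure.sum fun i : Set.Ici m => ENNReal.ofReal (thetaP θ i s) • Measure.dirac i := rfl

theorem integrable_thetaKernel {E : Type*} [NormedAddCommGroup E] (hθ : 0 < θ) (hm : θ ^ 2 = 1 / m)
    {g : Set.Ici m → E} {C : ℝ} (hg : ∀ i, ‖g i‖ ≤ C) (s : Set.Icc (0 : ℝ) θ) :
    Integrable g (thetaKernel m θ s) := by
  have := isMarkovKernel_thetaKernel hθ hm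
  exact Integrable.of_bound (StronglyMeasurable.of_discrete).aestronglyMeasurable C
    (ae_of_all _ hg)

variable {E : Type*} [NormedAddCommGroup E] [NormedSpace ℝ E] [CompleteSpace E]

theorem hasSum_integral_thetaKernel (hθ : 0 < θ) (hm : θ ^ 2 = 1 / m) {g : Set.Ici m → E} {C : ℝ}
    (hg : ∀ i, ‖g i‖ ≤ C) (s : Set.Icc (0 : ℝ) θ) :
    HasSum (fun i : Set.Ici m => thetaP θ i s • g i) (∫ i, g i ∂(thetaKernel m θ s)) := by
  have h := integrable_thetaKernel hθ hm hg s
  rw [thetaKernel_apply] at h ⊢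
  convert hasSum_integral_measure h using 2 with i
  rw [integral_smul_measure, integral_dirac, ENNReal.toReal_ofReal (thetaP_nonneg hθ _ s.2.1)]

theorem norm_integral_thetaKernel_sub_le (hθ : 0 < θ) (hm : θ ^ 2 = 1 / m) {g : Set.Ici m → E}
    {C : ℝ} (hg : ∀ i, ‖g i‖ ≤ C) (v w : Set.Icc (0 : ℝ) θ) :
    ‖∫ i, g i ∂(thetaKernel m θ v) - ∫ i, g i ∂(thetaKernel m θ w)‖ ≤ θ * dist v w * C := by
  -- The relative bound refers to the smaller point, whereas the claim is symmetric.
  wlog hvw : (v : ℝ) ≤ w generalizing v w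
  · rw [norm_sub_rev, dist_comm]
    exact this w v (le_of_not_ge hvw)
  have hC : 0 ≤ C := (norm_nonneg _).trans (hg ⟨m, Set.mem_Ici.2 le_rfl⟩)
  rw [norm_sub_rev]
  have h := (hasSum_integral_thetaKernel hθ hm hg w).sub (hasSum_integral_thetaKernel hθ hm hg v)
  have hd : dist v w = (w : ℝ) - v := by
    rw [Subtype.dist_eq, dist_comm, Real.dist_eq, abs_of_nonneg (sub_nonneg.2 hvw)]
  have hb := ((hasSum_thetaP_Ici hθ hm v.2.1).mul_left (θ * dist v w)).mul_right C
  rw [mul_one] at hb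
  refine h.norm_le_of_bounded hb fun i => ?_
  rw [← sub_smul, norm_smul, hd, Real.norm_eq_abs]
  exact mul_le_mul (abs_thetaP_sub_le_of_le hθ hm i.2 v.2.1 hvw) (hg i) (norm_nonneg _)
    (mul_nonneg (mul_nonneg hθ.le (sub_nonneg.2 hvw)) (thetaP_nonneg hθ _ v.2.1))

theorem dist_thetaMap_le (hθ : 0 < θ) (hm : θ ^ 2 = 1 / m) (v w : Set.Icc (0 : ℝ) θ)
    (i : Set.Ici m) :
    dist (thetaMap m θ hθ hm (v, i)) (thetaMap m θ hθ hm (w, i)) ≤ θ ^ 2 * dist v w := by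
  rw [Subtype.dist_eq, Subtype.dist_eq, Real.dist_eq, Real.dist_eq]
  exact abs_inv_sub_inv_theta_le hθ hm i.2 v.2.1 w.2.1

theorem markovOp_thetaQ_apply (hθ : 0 < θ) (hm : θ ^ 2 = 1 / m) {f : Set.Icc (0 : ℝ) θ → ℂ}
    (hf : Measurable f) (s : Set.Icc (0 : ℝ) θ) :
    markovOp (thetaRSCC m θ hθ hm).Q f s
      = ∫ i, f (thetaMap m θ hθ hm (s, i)) ∂(thetaKernel m θ s) := by
  change ∫ x, f x ∂((thetaKernel m θ s).map fun i => thetaMap m θ hθ hm (s, i)) = _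
  exact integral_map ((measurable_thetaMap m θ hθ hm).comp measurable_prodMk_left).aemeasurable
    hf.aestronglyMeasurable

/-- The factor is `θ²` from moving the maps plus `θ · θ/2` from moving the weights. -/
theorem contractsLip_thetaQ (hθ : 0 < θ) (hm : θ ^ 2 = 1 / m) :
    ContractsLip (thetaRSCC m θ hθ hm).Q (3 / 2 * ⟨θ, hθ.le⟩ ^ 2) := by
  intro K f hf
  refine LipschitzWith.of_dist_le_mul fun v w => ?_
  have hmeas := hf.continuous.measurable
  -- Centring at the midpoint bounds `f - f c` by `K θ/2`. Centring at an endpoint would give the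
  -- total factor `2θ²`, which equals `1` when `m = 2`.
  let c : Set.Icc (0 : ℝ) θ := ⟨θ / 2, by constructor <;> linarith⟩
  let g : Set.Icc (0 : ℝ) θ → Set.Ici m → ℂ := fun s i => f (thetaMap m θ hθ hm (s, i)) - f c
  have hg : ∀ s i, ‖g s i‖ ≤ K * (θ / 2) := by
    intro s i
    change ‖f _ - f c‖ ≤ _
    rw [← dist_eq_norm]
    refine (hf.dist_le_mul _ _).trans (mul_le_mul_of_nonneg_left ?_ K.coe_nonneg)
    rw [Subtype.dist_eq, Real.dist_eq, abs_le]
    have h := (thetaMap m θ hθ hm (s, i)).2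
    change -(θ / 2) ≤ _ - θ / 2 ∧ _ - θ / 2 ≤ θ / 2
    constructor <;> linarith [h.1, h.2]
  have := isMarkovKernel_thetaKernel hθ hm
  have hop : ∀ s, markovOp (thetaRSCC m θ hθ hm).Q f s = ∫ i, g s i ∂(thetaKernel m θ s) + f c := by
    intro s
    have h := integral_add (integrable_thetaKernel hθ hm (hg s) s)
      (integrable_const (f c) (μ := thetaKernel m θ s))
    simp only [g, sub_add_cancel, integral_const, probReal_univ, one_smul] at h
    rw [markovOp_thetaQ_apply hθ hm hmeas]
    exact h
  rw [hop, hop, dist_add_right, dist_eq_norm]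
  -- First the maps change with the weights held at `v`, then the weights change with the maps held
  -- at `w`.
  have hsplit : ∫ i, g v i ∂(thetaKernel m θ v) - ∫ i, g w i ∂(thetaKernel m θ w)
      = ∫ i, (g v i - g w i) ∂(thetaKernel m θ v)
        + (∫ i, g w i ∂(thetaKernel m θ v) - ∫ i, g w i ∂(thetaKernel m θ w)) := by
    rw [integral_sub (integrable_thetaKernel hθ hm (hg v) v)
      (integrable_thetaKernel hθ hm (hg w) v)]
    ring
  rw [hsplit]
  refine (norm_add_le _ _).trans ?_
  have h1 : ‖∫ i, (g v i - g w i) ∂(thetaKernel m θ v)‖ ≤ K * (θ ^ 2 * dist v w) := by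
    refine (norm_integral_le_of_norm_le_const (μ := thetaKernel m θ v)
      (C := K * (θ ^ 2 * dist v w)) (ae_of_all _ fun i => ?_)).trans (by simp)
    rw [sub_sub_sub_cancel_right, ← dist_eq_norm]
    exact (hf.dist_le_mul _ _).trans
      (mul_le_mul_of_nonneg_left (dist_thetaMap_le hθ hm v w i) K.coe_nonneg)
  have h2 := norm_integral_thetaKernel_sub_le hθ hm (hg w) v w
  refine (add_le_add h1 h2).trans (le_of_eq ?_)
  push_cast
  change _ = 3 / 2 * θ ^ 2 * K * dist v w
  ring

/-! ### The constants `r_1` and `R_1` -/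

theorem RSCC.Pn_one_apply {W X : Type*} [MeasurableSpace W] [MeasurableSpace X] (S : RSCC W X)
    (w : W) : S.Pn 1 w = (S.P w).map fun x _ => x := by
  have hc : Measurable fun (x : X) (_ : Fin 1) => x :=
    measurable_pi_lambda _ fun _ => measurable_id
  ext A hA
  rw [RSCC.Pn, Kernel.map_apply' _ (RSCC.measurable_append 0) _ hA,
    Kernel.compProd_apply (RSCC.measurable_append 0 hA), RSCC.Pn,
    Kernel.lintegral_deterministic' _ Subsingleton.measurable, Kernel.comap_apply,
    Measure.map_apply hc hA]
  congr 1

theorem thetaRSCC_r_one_le (hθ : 0 < θ) (hm : θ ^ 2 = 1 / m) :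
    (thetaRSCC m θ hθ hm).r 1 ≤ ENNReal.ofReal (θ ^ 2) := by
  refine iSup_le fun v => iSup_le fun w => iSup_le fun hvw => ?_
  have hle : ∀ x : Fin 1 → Set.Ici m,
      edist ((thetaRSCC m θ hθ hm).path 1 v x) ((thetaRSCC m θ hθ hm).path 1 w x) / edist v w
        ≤ ENNReal.ofReal (θ ^ 2) := by
    intro x
    rw [ENNReal.div_le_iff (edist_pos.2 hvw).ne' (edist_ne_top v w), edist_dist, edist_dist,
      ← ENNReal.ofReal_mul (sq_nonneg θ)]
    exact ENNReal.ofReal_le_ofReal (dist_thetaMap_le hθ hm v w _)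
  exact (lintegral_mono hle).trans (by simp)

/-- This is the total-variation bound for the weights, applied to an indicator function. -/
theorem thetaRSCC_R_one_le (hθ : 0 < θ) (hm : θ ^ 2 = 1 / m) :
    (thetaRSCC m θ hθ hm).R 1 ≤ ENNReal.ofReal θ := by
  refine iSup_le fun A => iSup_le fun hA => ?_
  change _ ≤ ((θ.toNNReal : ℝ≥0) : ℝ≥0∞)
  rw [lipSemi_le_coe_iff]
  refine LipschitzWith.of_dist_le_mul fun v w => ?_
  have hc : Measurable fun (x : Set.Ici m) (_ : Fin 1) => x :=
    measurable_pi_lambda _ fun _ => measurable_id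
  have happ : ∀ s, ((thetaRSCC m θ hθ hm).Pn 1 s).real A
      = ∫ i, ((fun (x : Set.Ici m) (_ : Fin 1) => x) ⁻¹' A).indicator (fun _ => (1 : ℝ)) i
          ∂(thetaKernel m θ s) := by
    intro s
    rw [RSCC.Pn_one_apply, map_measureReal_apply hc hA, integral_indicator_const _ (hc hA),
      smul_eq_mul, mul_one]
    rfl
  rw [happ, happ, dist_eq_norm, Real.coe_toNNReal _ hθ.le]
  refine (norm_integral_thetaKernel_sub_le hθ hm (C := 1) (fun i => ?_) v w).trans
    (mul_one _).le
  exact (norm_indicator_le_norm_self _ _).trans (by simp)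

theorem thetaRSCC_withContraction (hθ : 0 < θ) (hθ1 : θ < 1) (hm : θ ^ 2 = 1 / m) :
    (thetaRSCC m θ hθ hm).WithContraction := by
  have hr := thetaRSCC_r_one_le hθ hm
  refine ⟨inferInstance, hr.trans_lt ENNReal.ofReal_lt_top,
    (thetaRSCC_R_one_le hθ hm).trans_lt ENNReal.ofReal_lt_top, 1, le_rfl, hr.trans_lt ?_⟩
  rw [← ENNReal.ofReal_one, ENNReal.ofReal_lt_ofReal_iff one_pos]
  exact pow_lt_one₀ hθ.le hθ1 two_ne_zero

instance isMarkovKernel_thetaQ (hθ : 0 < θ) (hm : θ ^ 2 = 1 / m) :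
    IsMarkovKernel (thetaRSCC m θ hθ hm).Q := by
  have := isMarkovKernel_thetaKernel hθ hm
  exact ⟨fun s => Measure.isProbabilityMeasure_map
    ((measurable_thetaMap m θ hθ hm).comp measurable_prodMk_left).aemeasurable⟩

end ThetaExpansion

/-! ### Invariance of `γ_θ` -/

section InvariantMeasure

variable {m : ℕ} {θ : ℝ}

/-- The half-open interval differs from `[0, θ]` by a null set and makes the images under the `u_i`
disjoint: at the endpoints, `u_i(θ) = u_{i+1}(0)`. -/
theorem lintegral_gammaTheta {G : ℝ → ℝ≥0∞} (hG : Measurable G) :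
    ∫⁻ x, G x ∂(gammaTheta θ) = ENNReal.ofReal (1 / Real.log (1 + θ ^ 2)) *
      ∫⁻ x in Set.Ico 0 θ, ENNReal.ofReal (θ / (1 + θ * x)) * G x := by
  have hρ : Measurable fun x : ℝ => ENNReal.ofReal (θ / (1 + θ * x)) := by fun_prop
  rw [gammaTheta, lintegral_smul_measure, smul_eq_mul, Measure.restrict_congr_set Ico_ae_eq_Icc,
    ← lintegral_subtype_comap measurableSet_Icc]
  congr 1
  exact lintegral_withDensity_eq_lintegral_mul _
    (hρ.comp measurable_subtype_coe) (hG.comp measurable_subtype_coe)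

theorem gammaTheta_apply {B : Set ℝ} (hB : MeasurableSet B) :
    gammaTheta θ (Subtype.val ⁻¹' B) = ENNReal.ofReal (1 / Real.log (1 + θ ^ 2)) *
      ∫⁻ x in Set.Ico 0 θ, ENNReal.ofReal (θ / (1 + θ * x)) * B.indicator 1 x := by
  rw [← lintegral_gammaTheta (measurable_one.indicator hB),
    ← lintegral_indicator_one (measurable_subtype_coe hB)]
  rfl

theorem isProbabilityMeasure_gammaTheta (hθ : 0 < θ) :
    IsProbabilityMeasure (gammaTheta θ) := by
  refine ⟨?_⟩
  rw [← Set.preimage_univ (f := Subtype.val), gammaTheta_apply MeasurableSet.univ]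
  simp only [Set.indicator_univ, Pi.one_apply, mul_one]
  have hpos : ∀ x ∈ Set.Icc 0 θ, 0 < 1 + θ * x := fun x hx => by
    have := mul_nonneg hθ.le hx.1
    linarith
  have hcont : ContinuousOn (fun x => θ / (1 + θ * x)) (Set.Icc 0 θ) :=
    continuousOn_const.div (by fun_prop) fun x hx => (hpos x hx).ne'
  have hint : ∫ x in Set.Ico 0 θ, θ / (1 + θ * x) = Real.log (1 + θ ^ 2) := by
    rw [integral_Ico_eq_integral_Ioc, ← intervalIntegral.integral_of_le hθ.le]
    rw [← Set.uIcc_of_le hθ.le] at hcont hpos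
    rw [intervalIntegral.integral_eq_sub_of_hasDerivAt (f := fun x => Real.log (1 + θ * x))
      (fun x hx => ?_) hcont.intervalIntegrable]
    · simp [sq]
    · have h := ((hasDerivAt_id x).const_mul θ).const_add 1
      simpa using h.log (hpos x hx).ne'
  have hlog : 0 < Real.log (1 + θ ^ 2) := Real.log_pos (by have := pow_pos hθ 2; linarith)
  rw [← ofReal_integral_eq_lintegral_ofReal
    ((hcont.integrableOn_compact isCompact_Icc).mono_set Set.Ico_subset_Icc_self), hint,
    ← ENNReal.ofReal_mul (by positivity), one_div_mul_cancel hlog.ne', ENNReal.ofReal_one]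
  refine (ae_restrict_iff' measurableSet_Ico).2 (ae_of_all _ fun x hx => ?_)
  exact div_nonneg hθ.le (hpos x (Set.Ico_subset_Icc_self hx)).le

/-- Uniqueness of the quotient in division by `θ` with remainder in `[0, θ)`. -/
theorem add_natCast_mul_injective (hθ : 0 < θ) {s t : ℝ} (hs : s ∈ Set.Ico 0 θ)
    (ht : t ∈ Set.Ico 0 θ) {i j : ℕ} (h : s + i * θ = t + j * θ) : i = j := by
  have aux : ∀ {s t : ℝ} {i j : ℕ}, 0 ≤ s → t < θ → s + i * θ = t + j * θ → i ≤ j := by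
    intro s t i j hs ht h
    have : (i : ℝ) < j + 1 := by
      by_contra hlt
      nlinarith [mul_le_mul_of_nonneg_right (not_lt.1 hlt) hθ.le]
    exact_mod_cast Nat.lt_succ_iff.1 (by exact_mod_cast this)
  exact le_antisymm (aux hs.1 ht.2 h) (aux ht.1 hs.2 h.symm)

theorem iUnion_image_inv_add (hθ : 0 < θ) (hm : θ ^ 2 = 1 / m) :
    ⋃ i : Set.Ici m, (fun s : ℝ => 1 / (s + (i : ℕ) * θ)) '' Set.Ico 0 θ = Set.Ioc 0 θ := by
  ext y
  simp only [Set.mem_iUnion, Set.mem_image]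
  constructor
  · rintro ⟨i, s, hs, rfl⟩
    have h := inv_theta_le hθ hm i.2 hs.1
    have h0 : 0 < 1 / θ := by positivity
    exact ⟨one_div_pos.2 (h0.trans_le h), by simpa using one_div_le_one_div_of_le h0 h⟩
  · rintro ⟨hy0, hy⟩
    have h1 : 1 / θ ≤ 1 / y := one_div_le_one_div_of_le hy0 hy
    have hq : 0 ≤ 1 / y / θ := by positivity
    -- Division of `1/y` by `θ`: the quotient is the digit `i`, the remainder is the preimage `s`.
    refine ⟨⟨⌊1 / y / θ⌋₊, Set.mem_Ici.2 (Nat.le_floor ?_)⟩, 1 / y - ⌊1 / y / θ⌋₊ * θ,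
      ⟨?_, ?_⟩, ?_⟩
    · rw [le_div_iff₀ hθ, mul_theta_eq_inv hθ hm]
      exact h1
    · rw [sub_nonneg, ← le_div_iff₀ hθ]
      exact Nat.floor_le hq
    · have := (div_lt_iff₀ hθ).1 (Nat.lt_floor_add_one (1 / y / θ))
      linarith
    · simp

/-- Change of variables `x = 1/a` with `a = s + iθ`. Both `ρ(1/a) / a²` and `ρ(s) P_i(s)` equal `θ /
(a (a + θ))`, the numerator of `P_i` cancelling the denominator of `ρ`. -/
theorem lintegral_thetaP_mul (hθ : 0 < θ) (hm : θ ^ 2 = 1 / m) (i : Set.Ici m)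
    (G : ℝ → ℝ≥0∞) :
    ∫⁻ x in (fun s : ℝ => 1 / (s + (i : ℕ) * θ)) '' Set.Ico 0 θ,
        ENNReal.ofReal (θ / (1 + θ * x)) * G x
      = ∫⁻ s in Set.Ico 0 θ, ENNReal.ofReal (θ / (1 + θ * s)) *
          (ENNReal.ofReal (thetaP θ i s) * G (1 / (s + (i : ℕ) * θ))) := by
  have hpos : ∀ s ∈ Set.Ico 0 θ, 0 < s + (i : ℕ) * θ := fun s hs =>
    (one_div_pos.2 hθ).trans_le (inv_theta_le hθ hm i.2 hs.1)
  rw [lintegral_image_eq_lintegral_abs_deriv_mul (f' := fun s => -1 / (s + (i : ℕ) * θ) ^ 2)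
    measurableSet_Ico]
  · refine setLIntegral_congr_fun measurableSet_Ico fun s hs => ?_
    have ha := hpos s hs
    have hs0 : 0 < 1 + θ * s := by have := mul_nonneg hθ.le hs.1; linarith
    rw [← mul_assoc, ← mul_assoc, ← ENNReal.ofReal_mul (abs_nonneg _),
      ← ENNReal.ofReal_mul (by positivity)]
    congr 2
    rw [abs_div, abs_neg, abs_one, abs_of_pos (pow_pos ha 2), thetaP]
    have h1 : s + ((i : ℕ) + 1) * θ = (s + (i : ℕ) * θ) + θ := by ring
    rw [h1]
    have h2 : s * θ + 1 ≠ 0 := by linarith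
    have h3 : (s + (i : ℕ) * θ) + θ ≠ 0 := by positivity
    generalize s + (i : ℕ) * θ = a at *
    have h4 : 1 + θ * (1 / a) = (a + θ) / a := by field_simp
    rw [h4]
    field_simp
    ring
  · intro s hs
    have h := ((hasDerivAt_id s).add_const ((i : ℕ) * θ)).inv (hpos s hs).ne'
    simp only [one_div]
    exact h.hasDerivWithinAt
  · intro s hs t ht h
    have h' : s + (i : ℕ) * θ = t + (i : ℕ) * θ := by simpa using h
    linarith

theorem thetaQ_apply (hθ : 0 < θ) (hm : θ ^ 2 = 1 / m) {B : Set ℝ} (hB : MeasurableSet B)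
    (s : Set.Icc (0 : ℝ) θ) :
    (thetaRSCC m θ hθ hm).Q s (Subtype.val ⁻¹' B)
      = ∑' i : Set.Ici m, ENNReal.ofReal (thetaP θ i s) *
          B.indicator 1 (1 / ((s : ℝ) + (i : ℕ) * θ)) := by
  have hmap : Measurable fun i => thetaMap m θ hθ hm (s, i) :=
    (measurable_thetaMap m θ hθ hm).comp measurable_prodMk_left
  change ((thetaKernel m θ s).map fun i => thetaMap m θ hθ hm (s, i)) _ = _
  rw [Measure.map_apply hmap (measurable_subtype_coe hB), thetaKernel_apply,
    Measure.sum_apply _ (hmap (measurable_subtype_coe hB))]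
  refine tsum_congr fun i => ?_
  rw [Measure.smul_apply, smul_eq_mul,
    Measure.dirac_apply' _ (hmap (measurable_subtype_coe hB))]
  rfl

theorem invariant_gammaTheta (hθ : 0 < θ) (hm : θ ^ 2 = 1 / m) :
    Kernel.Invariant (thetaRSCC m θ hθ hm).Q (gammaTheta θ) := by
  refine Measure.ext fun B' hB' => ?_
  obtain ⟨B, hB, rfl⟩ := hB'
  have hterm : ∀ i : Set.Ici m, Measurable fun s : ℝ => ENNReal.ofReal (thetaP θ i s) *
      B.indicator (1 : ℝ → ℝ≥0∞) (1 / (s + (i : ℕ) * θ)) := by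
    intro i
    refine Measurable.mul ?_ ((measurable_one.indicator hB).comp (by fun_prop))
    unfold thetaP
    fun_prop
  rw [Measure.bind_apply (measurable_subtype_coe hB) (Kernel.aemeasurable _),
    gammaTheta_apply hB]
  simp only [thetaQ_apply hθ hm hB]
  rw [lintegral_gammaTheta (G := fun s => ∑' i : Set.Ici m, ENNReal.ofReal (thetaP θ i s) *
      B.indicator 1 (1 / (s + (i : ℕ) * θ))) (Measurable.tsum hterm)]
  congr 1
  simp only [← ENNReal.tsum_mul_left]
  have hρ : Measurable fun s : ℝ => ENNReal.ofReal (θ / (1 + θ * s)) := by fun_prop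
  rw [lintegral_tsum (fun i => by exact (hρ.mul (hterm i)).aemeasurable)]
  -- Each summand becomes an integral over one tile `u_i([0, θ))`; the tiles are disjoint and fill
  -- `(0, θ]`, so the sum is a single integral.
  simp only [← lintegral_thetaP_mul hθ hm _ (B.indicator 1)]
  rw [← lintegral_iUnion, iUnion_image_inv_add hθ hm, Measure.restrict_congr_set
    (Ioc_ae_eq_Icc.trans Ico_ae_eq_Icc.symm)]
  · intro i
    refine measurableSet_Ico.image_of_continuousOn_injOn ?_ ?_
    · refine continuousOn_const.div (by fun_prop) fun s hs => ?_
      exact ((one_div_pos.2 hθ).trans_le (inv_theta_le hθ hm i.2 hs.1)).ne'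
    · intro s hs t ht h
      have h' : s + (i : ℕ) * θ = t + (i : ℕ) * θ := by simpa using h
      linarith
  · intro i j hij
    refine Set.disjoint_left.2 ?_
    rintro _ ⟨s, hs, rfl⟩ ⟨t, ht, h⟩
    have h' : t + (j : ℕ) * θ = s + (i : ℕ) * θ := by simpa using h
    exact hij (Subtype.ext (add_natCast_mul_injective hθ hs ht h'.symm))

end InvariantMeasure

/-! ### The main theorem -/

theorem mainTheorem2 (m : ℕ) (θ : ℝ) (hθ0 : 0 < θ) (_hθ1 : θ < 1) (hθm : θ ^ 2 = 1 / m) :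
    (thetaRSCC m θ hθ0 hθm).WithContraction ∧
    IsDoeblinFortet (thetaRSCC m θ hθ0 hθm).Q ∧
    IsRegularOnLip (thetaRSCC m θ hθ0 hθm).Q ∧
    IsProbabilityMeasure (gammaTheta θ) ∧
    Kernel.Invariant (thetaRSCC m θ hθ0 hθm).Q (gammaTheta θ) ∧
    ∃ q K : ℝ, 0 < q ∧ q < 1 ∧ 0 < K ∧
      ∀ (f : LipFun (Set.Icc (0 : ℝ) θ)) (n : ℕ), 1 ≤ n →
        lipNorm (fun s => markovOp ((thetaRSCC m θ hθ0 hθm).Q ^ n) f s - ∫ x, f x ∂(gammaTheta θ))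
          ≤ ENNReal.ofReal (K * q ^ n * ‖f‖) := by
  have hprob := isProbabilityMeasure_gammaTheta hθ0
  have hinv := invariant_gammaTheta hθ0 hθm
  have hQ := contractsLip_thetaQ hθ0 hθm
  have hmarkov := isMarkovKernel_thetaQ hθ0 hθm
  have hc : (3 / 2 * ⟨θ, hθ0.le⟩ ^ 2 : ℝ≥0) < 1 := by
    rw [← NNReal.coe_lt_coe]
    push_cast
    change 3 / 2 * θ ^ 2 < 1
    linarith [two_mul_sq_theta_le_one hθ0 _hθ1 hθm]
  have hD : ∀ v w : Set.Icc (0 : ℝ) θ, dist v w ≤ θ := fun v w => by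
    simpa [Subtype.dist_eq] using Real.dist_le_of_mem_Icc v.2 w.2
  refine ⟨thetaRSCC_withContraction hθ0 _hθ1 hθm, isDoeblinFortet_of_contractsLip hQ hc,
    isRegularOnLip_of_contractsLip hQ hc hinv hD, hprob, hinv,
    -- The rate `q` is the one-step contraction factor, and `K = 1 + D` with diameter bound `D = θ`.
    ((3 / 2 * ⟨θ, hθ0.le⟩ ^ 2 : ℝ≥0) : ℝ), 1 + θ, ?_, by exact_mod_cast hc, by positivity,
    fun f n _ => lipNorm_markovOp_pow_sub_le hQ hinv hD n f⟩
  push_cast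
  change 0 < 3 / 2 * θ ^ 2
  positivity
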